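/- **Theorem 1 (False Alarm Theorem).** Let $\psi$ be a unit-energy baseband pulse of bandwidth at most the sampling rate (normalized to one), i.e. $\psi(t)=\int_{-1/2}^{1/2} g(f)e^{2\pi j f t}\,df$ with $\int_{-1/2}^{1/2}|g(f)|^2df=1$; for instance $\psi(t)=\operatorname{sinc}(t)=\sin(\pi t)/(\pi t)$. For an observation interval $[-N/2,N/2)$ of time–bandwidth product $N=TB\in\mathbb N$, sampled at $n=-N/2,\dots,N/2-1$, write $\mathbf u(x)=(\psi(n-x))_n$. A single point target has state $v\in\{0,1\}$ (absent, present) with prior $\pi(v)\ge 0$, $\pi(0)+\pi(1)=1$; it has constant modulus $\alpha\ge 0$, phase $\varphi$ uniform on $[0,2\pi]$ (Swerling 0) and delay $x$ uniform on $[-N/2,N/2)$, and is received in complex white Gaussian noise whose samples are i.i.d. $\mathcal{CN}(0,N_0)$, $N_0>0$. Treating the received energy of a present target as $\alpha^2$, i.e. taking $$p(\mathbf y\mid v,x,\varphi)=(\pi N_0)^{-N}\exp\Big[-\tfrac1{N_0}\big(\mathbf y^{\mathrm H}\mathbf y+v\alpha^2\big)\Big]\exp\Big\{\tfrac2{N_0}\operatorname{Re}\big[v\alpha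 e^{-j\varphi}\mathbf u^{\mathrm H}(x)\mathbf y\big]\Big\},$$ let $p(\mathbf y\mid v)$ be its average over $\varphi$ and $x$, let $P(v\mid\mathbf y)=\pi(v)p(\mathbf y\mid v)/\sum_{v'}\pi(v')p(\mathbf y\mid v')$ be the posterior probability, and let $P_{\mathrm{FA}}(N)=\mathrm E_{\mathbf y_0}[P(1\mid\mathbf y_0)]$ be the theoretical false alarm probability, where $\mathbf y_0$ is noise only. Then for every $N\ge 1$ $$P_{\mathrm{FA}}(N)=\mathrm E_{\mathbf y_0}\!\left[\frac{\pi(1)\Upsilon(1,\mathbf y_0)}{\pi(0)+\pi(1)\Upsilon(1,\mathbf y_0)}\right],\qquad \Upsilon(1,\mathbf y)=e^{-\rho^2}\,\frac1N\int_{-N/2}^{N/2} I_0\!\left(2\rho^2\,\frac{|\mathbf u^{\mathrm H}(x)\mathbf y|}{\alpha}\right)dx,$$ where $\rho^2=\alpha^2/N_0$ and $I_0$ is the zero-order modified Bessel function of the first kind (for $\alpha=0$ the argument of $I_0$ is read as $0$), and $$\lim_{N\to\infty}P_{\mathrm{FA}}(N)=\pi(1).$$ -/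

import Mathlib

open MeasureTheory ProbabilityTheory Filter Topology

namespace Radar

/-- `ψ` is a unit-energy baseband pulse, in the regularized time scale in which the sampling rate is
one: its (square integrable) spectrum `g` lives on the band `[-1/2, 1/2]` and has energy one. -/
def IsBasebandPulse (ψ : ℝ → ℂ) : Prop :=
  ∃ g : ℝ → ℂ, MemLp g 2 (volume.restrict (Set.Icc (-1 / 2 : ℝ) (1 / 2))) ∧
    (∫ f in (-1 / 2 : ℝ)..(1 / 2), ‖g f‖ ^ 2) = 1 ∧
    ∀ t : ℝ, ψ t = ∫ f in (-1 / 2 : ℝ)..(1 / 2),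
      g f * Complex.exp (2 * (Real.pi : ℂ) * Complex.I * (f : ℂ) * (t : ℂ))

/-- The normalized pulse `t ↦ sin (π t) / (π t)` is a unit-energy baseband pulse. -/
theorem isBasebandPulse_sinc : IsBasebandPulse fun t => (Real.sinc (Real.pi * t) : ℂ) := by
  refine ⟨fun _ => 1, memLp_const 1, by norm_num, fun t => ?_⟩
  rcases eq_or_ne t 0 with rfl | ht
  · norm_num
  · have hpi : (Real.pi : ℂ) ≠ 0 := by exact_mod_cast Real.pi_ne_zero
    have htc : (t : ℂ) ≠ 0 := by exact_mod_cast ht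
    have hc : (2 * (Real.pi : ℂ) * Complex.I * (t : ℂ)) ≠ 0 := by
      simp [hpi, htc, Complex.I_ne_zero]
    have h1 : ∀ f : ℝ, (1 : ℂ) * Complex.exp (2 * (Real.pi : ℂ) * Complex.I * (f : ℂ) * (t : ℂ))
        = Complex.exp ((2 * (Real.pi : ℂ) * Complex.I * (t : ℂ)) * (f : ℂ)) := fun f => by
      rw [one_mul]; congr 1; ring
    simp only [h1]
    rw [integral_exp_mul_complex hc,
      Real.sinc_of_ne_zero (mul_ne_zero Real.pi_ne_zero ht)]
    push_cast
    rw [Complex.sin]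
    have e1 : 2 * (Real.pi : ℂ) * Complex.I * t * (1 / 2) = Real.pi * t * Complex.I := by ring
    have e2 : 2 * (Real.pi : ℂ) * Complex.I * t * (-1 / 2) = -(Real.pi * t) * Complex.I := by ring
    rw [e1, e2]
    field_simp
    rw [Complex.I_sq]
    ring

/-- The `N` sampling times `-N/2, -N/2 + 1, …, N/2 - 1`. -/
noncomputable def sampleTime (N : ℕ) (k : Fin N) : ℝ := -(N : ℝ) / 2 + (k : ℝ)

/-- The sampled waveform `u(x) = (ψ(n - x))ₙ` of a target at regularized delay `x`. -/
noncomputable def waveform (ψ : ℝ → ℂ) (N : ℕ) (x : ℝ) : Fin N → ℂ :=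
  fun k => ψ (sampleTime N k - x)

/-- The matched filter output `u(x)ᴴ y`. -/
noncomputable def matchedFilter (ψ : ℝ → ℂ) (N : ℕ) (y : Fin N → ℂ) (x : ℝ) : ℂ :=
  ∑ k, (starRingEnd ℂ) (waveform ψ N x k) * y k

/-- The likelihood `p(y | v, x, φ)` of the received samples `y`, given the target state `v` (absent
or present), the delay `x` and the phase `φ` of a target of constant modulus `α` in complex white
Gaussian noise of variance `N₀`; the received signal energy of a present target is `α ^ 2`. -/
noncomputable def channelGiven (ψ : ℝ → ℂ) (α N₀ : ℝ) (N : ℕ) (v : Fin 2) (x φ : ℝ)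
    (y : Fin N → ℂ) : ℝ :=
  (1 / (Real.pi * N₀)) ^ N *
    Real.exp (-(1 / N₀) * ((∑ k, ‖y k‖ ^ 2) + (v.val : ℝ) * α ^ 2)) *
    Real.exp (2 / N₀ * ((v.val : ℂ) * (α : ℂ) * Complex.exp (-(Complex.I * (φ : ℂ))) *
      matchedFilter ψ N y x).re)

/-- The detection channel `p(y | v)`: the phase is uniform on `[0, 2π]` and the delay is uniform on
the observation interval `[-N/2, N/2)`. -/
noncomputable def channel (ψ : ℝ → ℂ) (α N₀ : ℝ) (N : ℕ) (v : Fin 2) (y : Fin N → ℂ) : ℝ :=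
  1 / (N : ℝ) * ∫ x in (-(N : ℝ) / 2)..((N : ℝ) / 2),
    1 / (2 * Real.pi) * ∫ φ in (0 : ℝ)..(2 * Real.pi), channelGiven ψ α N₀ N v x φ y

/-- The a posteriori probability `P(v | y)` of the target state, by the Bayes formula. -/
noncomputable def posterior (prior : Fin 2 → ℝ) (ψ : ℝ → ℂ) (α N₀ : ℝ) (N : ℕ) (v : Fin 2)
    (y : Fin N → ℂ) : ℝ :=
  prior v * channel ψ α N₀ N v y / ∑ v', prior v' * channel ψ α N₀ N v' y

/-- The circular complex Gaussian law of mean zero and variance `N₀`: real and imaginary parts are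
independent centred Gaussians of variance `N₀ / 2`. -/
noncomputable def complexGaussian (N₀ : ℝ) : Measure ℂ :=
  ((gaussianReal 0 (N₀ / 2).toNNReal).prod (gaussianReal 0 (N₀ / 2).toNNReal)).map
    Complex.measurableEquivRealProd.symm

/-- The law of the received vector when no target is present: `N` independent noise samples. -/
noncomputable def noiseLaw (N₀ : ℝ) (N : ℕ) : Measure (Fin N → ℂ) :=
  Measure.pi fun _ => complexGaussian N₀

/-- The theoretical false alarm probability: the expected a posteriori probability of target
presence when the received vector is noise only. -/
noncomputable def falseAlarmProb (prior : Fin 2 → ℝ) (ψ : ℝ → ℂ) (α N₀ : ℝ) (N : ℕ) : ℝ :=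
  ∫ y, posterior prior ψ α N₀ N 1 y ∂(noiseLaw N₀ N)

/-- The zero-order modified Bessel function of the first kind. -/
noncomputable def besselI0 (z : ℝ) : ℝ :=
  1 / (2 * Real.pi) * ∫ θ in (0 : ℝ)..(2 * Real.pi), Real.exp (z * Real.cos θ)

/-- The signal-to-noise ratio `ρ² = α² / N₀`. -/
noncomputable def snr (α N₀ : ℝ) : ℝ := α ^ 2 / N₀

/-- The detection statistic `Υ(v, y)`. -/
noncomputable def detectionStatistic (ψ : ℝ → ℂ) (α N₀ : ℝ) (N : ℕ) (v : Fin 2)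
    (y : Fin N → ℂ) : ℝ :=
  Real.exp (-((v.val : ℝ) * snr α N₀)) * (1 / (N : ℝ) *
    ∫ x in (-(N : ℝ) / 2)..((N : ℝ) / 2),
      besselI0 (2 * (v.val : ℝ) * snr α N₀ * ‖matchedFilter ψ N y x‖ / α))

end Radar

/-!
# Why the false alarm probability tends to the prior

Averaging the likelihood over the phase turns the exponential into a Bessel function, so that
`p(y | 1) = p(y | 0) Υ(1, y)` and the factor `p(y | 0) > 0` cancels in the Bayes formula
(`channel_eq`, `posterior_one_eq`). The posterior probability is then a function of `Υ(1, y)` which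
takes the value `π(1)` at `1` and moves away from it by at most `|Υ(1, y) - 1|`
(`abs_posterior_sub_le`). It is therefore enough that `Υ(1, ·)` converges to one in quadratic mean
under noise, a law of large numbers over the delays
(`tendsto_integral_detectionStatistic_sub_one_sq`).

`Υ(1, y)` is the average of the likelihood ratios `likelihoodRatio` of targets of known delay and
phase over the uniform law `delayPhaseLaw` of these parameters, and the Laplace transform of the
noise (`integral_exp_re_noiseLaw`) gives the moments of the ratios:

* the mean is `exp (ρ² (s(x) - 1))`, where `s(x) = ‖u(x)‖²` is the energy of the sampled waveform;
  `s(x) ≤ 1` by Parseval's identity on the band (`IsBasebandPulse.hasSum_norm_sq`), and the mean of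
  `s` over the delays tends to one because energy is lost only near the ends of the observation
  interval (`IsBasebandPulse.tendsto_mean_intervalIntegral_norm_sq`);
* the mean of the product of two ratios is at most `exp (2 ρ² r) ≤ 1 + (exp (2 ρ²) - 1) r`, where
  `r(x, x') = ∑ₙ |ψ(n - x)| |ψ(n - x')| ≤ 1`. The two delays separate in each term of `r`, so the
  mean of `r` is at most `(∫ |ψ|)² / N` with the integral over `[-N, N]` (`integral_overlap_le`),
  and this tends to zero because `ψ` is square integrable
  (`IsBasebandPulse.tendsto_sq_intervalIntegral_norm_div`).

No decay of the pulse beyond square integrability is available: the spectrum `g` is only assumed to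
be square integrable.
-/

namespace Radar

/-! ### Energy of a baseband pulse -/

theorem norm_exp_modulation (f t : ℝ) :
    ‖Complex.exp (2 * (Real.pi : ℂ) * Complex.I * (f : ℂ) * (t : ℂ))‖ = 1 := by
  rw [show 2 * (Real.pi : ℂ) * Complex.I * (f : ℂ) * (t : ℂ)
    = ((2 * Real.pi * f * t : ℝ) : ℂ) * Complex.I by push_cast; ring]
  exact Complex.norm_exp_ofReal_mul_I _

namespace IsBasebandPulse

variable {ψ : ℝ → ℂ}

theorem continuous (hψ : IsBasebandPulse ψ) : Continuous ψ := by
  obtain ⟨g, hg, -, hrep⟩ := hψ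
  have hle : (-1 / 2 : ℝ) ≤ 1 / 2 := by norm_num
  have hint : IntervalIntegrable g volume (-1 / 2 : ℝ) (1 / 2) := by
    rw [intervalIntegrable_iff_integrableOn_Icc_of_le hle]
    exact hg.integrable one_le_two
  rw [show ψ = _ from funext hrep]
  refine intervalIntegral.continuous_of_dominated_interval (bound := fun f => ‖g f‖)
    (fun t => ?_) (fun t => ae_of_all _ fun f _ => ?_) hint.norm (ae_of_all _ fun f _ => ?_)
  · refine AEStronglyMeasurable.mul ?_ (by fun_prop)
    rw [Set.uIoc_of_le hle]
    exact hint.1.aestronglyMeasurable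
  · rw [norm_mul, norm_exp_modulation, mul_one]
  · fun_prop

/-- Parseval's identity on the band: the integer samples of the pulse, at any offset, carry its
whole energy. They are the Fourier coefficients of a modulated spectrum. -/
theorem hasSum_norm_sq (hψ : IsBasebandPulse ψ) (t : ℝ) :
    HasSum (fun m : ℤ => ‖ψ (m + t)‖ ^ 2) 1 := by
  obtain ⟨g, hg, henergy, hrep⟩ := hψ
  have hlt : (-1 / 2 : ℝ) < 1 / 2 := by norm_num
  set h : ℝ → ℂ := fun f =>
    g f * Complex.exp (2 * (Real.pi : ℂ) * Complex.I * (f : ℂ) * (t : ℂ)) with hh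
  have hnorm : ∀ f, ‖h f‖ = ‖g f‖ := fun f => by rw [hh, norm_mul, norm_exp_modulation, mul_one]
  have hg' : MemLp g 2 (volume.restrict (Set.Ioc (-1 / 2 : ℝ) (1 / 2))) :=
    hg.mono_measure (Measure.restrict_mono Set.Ioc_subset_Icc_self le_rfl)
  have hL2 : MemLp h 2 (volume.restrict (Set.Ioc (-1 / 2 : ℝ) (1 / 2))) :=
    hg'.of_le (hg'.1.mul (by fun_prop)) (ae_of_all _ fun f => (hnorm f).le)
  have key := hasSum_sq_fourierCoeffOn hlt hL2
  have hone : ((1 / 2 - -1 / 2 : ℝ)⁻¹ • ∫ f in (-1 / 2 : ℝ)..(1 / 2), ‖h f‖ ^ 2) = 1 := by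
    simp only [hnorm, henergy]; norm_num
  rw [hone] at key
  have hcoeff : ∀ m : ℤ, fourierCoeffOn hlt h (-m) = ψ (m + t) := fun m => by
    rw [fourierCoeffOn_eq_integral, hrep]
    have : (1 / (1 / 2 - -1 / 2) : ℝ) = 1 := by norm_num
    rw [this, one_smul]
    refine intervalIntegral.integral_congr fun f _ => ?_
    simp only [neg_neg, fourier_coe_apply, smul_eq_mul, hh]
    rw [mul_left_comm, ← Complex.exp_add]
    congr 2
    push_cast
    norm_num
    ring
  have := (Equiv.neg ℤ).hasSum_iff.mpr key
  simpa only [Function.comp_def, Equiv.neg_apply, hcoeff] using this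

theorem intervalIntegrable_norm (hψ : IsBasebandPulse ψ) (a b : ℝ) :
    IntervalIntegrable (fun t => ‖ψ t‖) volume a b :=
  hψ.continuous.norm.intervalIntegrable a b

theorem intervalIntegrable_norm_sq (hψ : IsBasebandPulse ψ) (a b : ℝ) :
    IntervalIntegrable (fun t => ‖ψ t‖ ^ 2) volume a b :=
  (hψ.continuous.norm.pow 2).intervalIntegrable a b

theorem intervalIntegral_norm_sq_mono (hψ : IsBasebandPulse ψ) {a b a' b' : ℝ} (ha : a' ≤ a)
    (hab : a ≤ b) (hb : b ≤ b') : ∫ t in a..b, ‖ψ t‖ ^ 2 ≤ ∫ t in a'..b', ‖ψ t‖ ^ 2 :=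
  intervalIntegral.integral_mono_interval ha hab hb (ae_of_all _ fun _ => by positivity)
    (hψ.intervalIntegrable_norm_sq _ _)

/-- The pulse has unit energy in the time domain. -/
theorem tendsto_intervalIntegral_norm_sq (hψ : IsBasebandPulse ψ) :
    Tendsto (fun R : ℕ => ∫ t in (-(R : ℝ))..R, ‖ψ t‖ ^ 2) atTop (𝓝 1) := by
  have hfold : ∀ R : ℕ, ∫ t in (-(R : ℝ))..R, ‖ψ t‖ ^ 2
      = ∫ t in (0 : ℝ)..1, ∑ m ∈ Finset.Ico (-(R : ℤ)) R, ‖ψ (m + t)‖ ^ 2 := fun R => by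
    have hcont : ∀ m : ℤ, Continuous fun t : ℝ => ‖ψ (m + t)‖ ^ 2 := fun m =>
      (hψ.continuous.comp (continuous_const.add continuous_id)).norm.pow 2
    rw [intervalIntegral.integral_finsetSum fun m _ => (hcont m).intervalIntegrable _ _]
    simp only [intervalIntegral.integral_comp_add_left (fun t => ‖ψ t‖ ^ 2)]
    have := intervalIntegral.sum_integral_adjacent_intervals_Ico (f := fun t => ‖ψ t‖ ^ 2)
      (μ := volume) (a := fun k : ℕ => -(R : ℝ) + k) (m := 0) (n := 2 * R) (by omega)
      fun k _ => hψ.intervalIntegrable_norm_sq _ _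
    push_cast at this
    rw [show -(R : ℝ) + 0 = -R by ring, show -(R : ℝ) + 2 * R = R by ring] at this
    rw [← this]
    refine Finset.sum_bij (fun k _ => -(R : ℤ) + k) ?_ ?_ ?_ ?_
    · intro k hk; simp only [Finset.mem_Ico] at hk ⊢; omega
    · intro k _ l _ h; simpa using h
    · intro m hm
      simp only [Finset.mem_Ico] at hm
      exact ⟨(m + R).toNat, by simp only [Finset.mem_Ico]; omega, by omega⟩
    · intro k _; push_cast; congr 1 <;> ring
  simp only [hfold]
  have hlim : ∫ _ in (0 : ℝ)..1, (1 : ℝ) = 1 := by simp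
  conv => enter [3, 1]; rw [← hlim]
  refine intervalIntegral.tendsto_integral_filter_of_dominated_convergence (fun _ => 1)
    (Eventually.of_forall fun R => ?_) (Eventually.of_forall fun R => ae_of_all _ fun t _ => ?_)
    intervalIntegrable_const (ae_of_all _ fun t _ => ?_)
  · exact (continuous_finsetSum _ fun m _ => (hψ.continuous.comp
      (continuous_const.add continuous_id)).norm.pow 2).aestronglyMeasurable
  · rw [Real.norm_of_nonneg (Finset.sum_nonneg fun _ _ => by positivity)]
    exact sum_le_hasSum _ (fun _ _ => by positivity) (hψ.hasSum_norm_sq t)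
  · exact (hψ.hasSum_norm_sq t).comp Finset.tendsto_Ico_neg

theorem intervalIntegral_norm_sq_le_one (hψ : IsBasebandPulse ψ) {a b : ℝ} (hab : a ≤ b) :
    ∫ t in a..b, ‖ψ t‖ ^ 2 ≤ 1 := by
  obtain ⟨n, hn⟩ := exists_nat_ge (max (-a) b)
  refine ge_of_tendsto hψ.tendsto_intervalIntegral_norm_sq ?_
  filter_upwards [eventually_ge_atTop n] with R hR
  have hR' : (n : ℝ) ≤ R := by exact_mod_cast hR
  exact hψ.intervalIntegral_norm_sq_mono
    (by linarith [le_max_left (-a) b]) hab (by linarith [le_max_right (-a) b])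

/-- The `L¹` norm on `[-M, M]` is controlled by the energy of the pulse outside `[-R, R]`: on that
part, integrate the Peter–Paul inequality `‖ψ‖ ≤ (l ‖ψ‖² + l⁻¹) / 2`. -/
theorem intervalIntegral_norm_le (hψ : IsBasebandPulse ψ) {R M : ℕ} (hRM : R ≤ M) {l : ℝ}
    (hl : 0 < l) :
    ∫ t in (-(M : ℝ))..M, ‖ψ t‖ ≤ (∫ t in (-(R : ℝ))..R, ‖ψ t‖)
      + l / 2 * (1 - ∫ t in (-(R : ℝ))..R, ‖ψ t‖ ^ 2) + M / l := by
  have hRM' : (R : ℝ) ≤ M := by exact_mod_cast hRM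
  have hR : (0 : ℝ) ≤ R := R.cast_nonneg
  have hcalc : ∀ K : ℕ, ∫ t in (-(K : ℝ))..K, (l / 2 * ‖ψ t‖ ^ 2 + 1 / (2 * l) - ‖ψ t‖)
      = l / 2 * (∫ t in (-(K : ℝ))..K, ‖ψ t‖ ^ 2) + K / l - ∫ t in (-(K : ℝ))..K, ‖ψ t‖ := by
    intro K
    have h1 := (hψ.intervalIntegrable_norm_sq (-(K : ℝ)) K).const_mul (l / 2)
    rw [intervalIntegral.integral_sub (h1.add intervalIntegrable_const)
      (hψ.intervalIntegrable_norm _ _), intervalIntegral.integral_add h1 intervalIntegrable_const,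
      intervalIntegral.integral_const_mul, intervalIntegral.integral_const, smul_eq_mul]
    field_simp
    ring
  have hmono : ∫ t in (-(R : ℝ))..R, (l / 2 * ‖ψ t‖ ^ 2 + 1 / (2 * l) - ‖ψ t‖)
      ≤ ∫ t in (-(M : ℝ))..M, (l / 2 * ‖ψ t‖ ^ 2 + 1 / (2 * l) - ‖ψ t‖) := by
    refine intervalIntegral.integral_mono_interval (by linarith) (by linarith) hRM'
      (ae_of_all _ fun t => ?_) ?_
    · have : l / 2 * ‖ψ t‖ ^ 2 + 1 / (2 * l) - ‖ψ t‖ = (l * ‖ψ t‖ - 1) ^ 2 / (2 * l) := by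
        field_simp; ring
      simp only [this, Pi.zero_apply]
      positivity
    · exact (((hψ.intervalIntegrable_norm_sq _ _).const_mul (l / 2)).add
        intervalIntegrable_const).sub (hψ.intervalIntegrable_norm _ _)
  rw [hcalc, hcalc] at hmono
  have hM := hψ.intervalIntegral_norm_sq_le_one (show -(M : ℝ) ≤ M by linarith)
  have : l / 2 * (∫ t in (-(M : ℝ))..M, ‖ψ t‖ ^ 2) ≤ l / 2 * 1 := by gcongr
  have : 0 ≤ (R : ℝ) / l := by positivity
  linarith

/-- A square integrable pulse has `L¹` norm `o(√M)` on `[-M, M]`. -/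
theorem tendsto_sq_intervalIntegral_norm_div (hψ : IsBasebandPulse ψ) :
    Tendsto (fun M : ℕ => (∫ t in (-(M : ℝ))..M, ‖ψ t‖) ^ 2 / M) atTop (𝓝 0) := by
  have hsqrt : Tendsto (fun M : ℕ => √(M : ℝ)) atTop atTop :=
    Real.tendsto_sqrt_atTop.comp tendsto_natCast_atTop_atTop
  have hroot : Tendsto (fun M : ℕ => (∫ t in (-(M : ℝ))..M, ‖ψ t‖) / √(M : ℝ)) atTop (𝓝 0) := by
    refine tendsto_order.2 ⟨fun a ha => Eventually.of_forall fun M => ha.trans_le ?_,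
      fun ε hε => ?_⟩
    · exact div_nonneg (intervalIntegral.integral_nonneg (by linarith [M.cast_nonneg (α := ℝ)])
        fun _ _ => norm_nonneg _) (Real.sqrt_nonneg _)
    · set δ := ε / 3 with hδ
      have hδ0 : 0 < δ := by positivity
      obtain ⟨R, hR⟩ := ((tendsto_order.1 hψ.tendsto_intervalIntegral_norm_sq).1 (1 - δ ^ 2)
        (by nlinarith)).exists
      have hsmall := (tendsto_order.1 ((tendsto_const_nhds
        (x := ∫ t in (-(R : ℝ))..R, ‖ψ t‖)).div_atTop hsqrt)).2 δ hδ0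
      filter_upwards [hsmall, eventually_ge_atTop R, eventually_gt_atTop 0] with M hM hRM hM0
      have hM0' : (0 : ℝ) < M := by exact_mod_cast hM0
      have hs : 0 < √(M : ℝ) := Real.sqrt_pos.2 hM0'
      have hss : √(M : ℝ) * √(M : ℝ) = M := Real.mul_self_sqrt hM0'.le
      -- the weight `√M / δ` balances the two error terms
      have hb := hψ.intervalIntegral_norm_le hRM (l := √(M : ℝ) / δ) (by positivity)
      have h1 : √(M : ℝ) / δ / 2 * (1 - ∫ t in (-(R : ℝ))..R, ‖ψ t‖ ^ 2)
          ≤ √(M : ℝ) / δ / 2 * δ ^ 2 := by gcongr; linarith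
      have h2 : √(M : ℝ) / δ / 2 * δ ^ 2 = √(M : ℝ) * (δ / 2) := by field_simp
      have h3 : (M : ℝ) / (√(M : ℝ) / δ) = √(M : ℝ) * δ := by
        field_simp; rw [sq, hss]
      rw [div_lt_iff₀ hs] at hM ⊢
      nlinarith
  have := hroot.pow 2
  simpa [div_pow] using this

/-- The part of the pulse energy that falls in an observation interval of length `N`, averaged over
the sampling times, tends to one: only samples near the ends of the interval lose energy. -/
theorem tendsto_mean_intervalIntegral_norm_sq (hψ : IsBasebandPulse ψ) :
    Tendsto (fun N : ℕ => (1 / (N : ℝ)) * ∑ k : Fin N, ∫ t in ((k : ℝ) - N)..k, ‖ψ t‖ ^ 2)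
      atTop (𝓝 1) := by
  refine tendsto_order.2 ⟨fun a ha => ?_, fun a ha => ?_⟩
  · obtain ⟨R, hR⟩ := ((tendsto_order.1 hψ.tendsto_intervalIntegral_norm_sq).1 a ha).exists
    set E := ∫ t in (-(R : ℝ))..R, ‖ψ t‖ ^ 2 with hE
    have hE0 : 0 ≤ E := intervalIntegral.integral_nonneg
      (by linarith [R.cast_nonneg (α := ℝ)]) fun _ _ => by positivity
    have hlim : Tendsto (fun N : ℕ => (1 - 2 * R / (N : ℝ)) * E) atTop (𝓝 ((1 - 0) * E)) :=
      (tendsto_const_nhds.sub (tendsto_const_nhds.div_atTop tendsto_natCast_atTop_atTop)).mul_const E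
    rw [sub_zero, one_mul] at hlim
    filter_upwards [(tendsto_order.1 hlim).1 a hR, eventually_gt_atTop (2 * R)] with N hN hRN
    refine hN.trans_le ?_
    have hN0 : (0 : ℝ) < N := by exact_mod_cast (by omega : 0 < N)
    rw [Fin.sum_univ_eq_sum_range (fun k => ∫ t in ((k : ℝ) - N)..k, ‖ψ t‖ ^ 2) N]
    have hsub : Finset.Ico R (N - R) ⊆ Finset.range N := fun k hk => by
      simp only [Finset.mem_Ico, Finset.mem_range] at hk ⊢; omega
    have hge : ((N : ℝ) - 2 * R) * E
        ≤ ∑ k ∈ Finset.range N, ∫ t in ((k : ℝ) - N)..k, ‖ψ t‖ ^ 2 := by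
      refine le_trans ?_ (Finset.sum_le_sum_of_subset_of_nonneg hsub fun k _ _ =>
        intervalIntegral.integral_nonneg (by linarith) fun _ _ => by positivity)
      have hcard : ((N : ℝ) - 2 * R) * E = ∑ _k ∈ Finset.Ico R (N - R), E := by
        rw [Finset.sum_const, Nat.card_Ico, nsmul_eq_mul, Nat.sub_sub, ← two_mul,
          Nat.cast_sub (by omega)]
        push_cast; ring
      rw [hcard]
      refine Finset.sum_le_sum fun k hk => ?_
      rw [Finset.mem_Ico] at hk
      have h1 : (R : ℝ) ≤ k := by exact_mod_cast hk.1
      have h2 : (k : ℝ) + R ≤ N := by exact_mod_cast (by omega : k + R ≤ N)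
      exact hψ.intervalIntegral_norm_sq_mono (by linarith)
        (by linarith [R.cast_nonneg (α := ℝ)]) h1
    calc (1 - 2 * R / (N : ℝ)) * E = 1 / (N : ℝ) * (((N : ℝ) - 2 * R) * E) := by field_simp
      _ ≤ _ := by gcongr
  · filter_upwards [eventually_gt_atTop 0] with N hN
    have hN0 : (0 : ℝ) < N := by exact_mod_cast hN
    refine lt_of_le_of_lt ?_ ha
    calc (1 / (N : ℝ)) * ∑ k : Fin N, ∫ t in ((k : ℝ) - N)..k, ‖ψ t‖ ^ 2
        ≤ (1 / (N : ℝ)) * ∑ _k : Fin N, (1 : ℝ) := by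
          gcongr with k _
          exact hψ.intervalIntegral_norm_sq_le_one (by linarith)
      _ = 1 := by simp [hN0.ne']

/-- The sampled waveform has energy at most one, whatever the delay. -/
theorem sum_norm_sq_waveform_le_one (hψ : IsBasebandPulse ψ) (N : ℕ) (x : ℝ) :
    ∑ k, ‖waveform ψ N x k‖ ^ 2 ≤ 1 := by
  have h := sum_le_hasSum ((Finset.range N).map Nat.castEmbedding) (fun _ _ => by positivity)
    (hψ.hasSum_norm_sq (-(N : ℝ) / 2 - x))
  rw [Finset.sum_map, ← Fin.sum_univ_eq_sum_range
    (fun k => ‖ψ (((Nat.castEmbedding k : ℤ) : ℝ) + (-(N : ℝ) / 2 - x))‖ ^ 2) N] at h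
  refine le_of_eq_of_le (Finset.sum_congr rfl fun k _ => ?_) h
  simp only [waveform, sampleTime, Nat.castEmbedding_apply, Int.cast_natCast]
  ring_nf

end IsBasebandPulse

/-! ### Exponential moments of the noise -/

instance (N₀ : ℝ) : IsProbabilityMeasure (complexGaussian N₀) :=
  Measure.isProbabilityMeasure_map Complex.measurableEquivRealProd.symm.measurable.aemeasurable

instance (N₀ : ℝ) (N : ℕ) : IsProbabilityMeasure (noiseLaw N₀ N) :=
  inferInstanceAs (IsProbabilityMeasure (Measure.pi _))

theorem re_conj_mul (w z : ℂ) : ((starRingEnd ℂ) w * z).re = w.re * z.re + w.im * z.im := by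
  simp [Complex.mul_re]

theorem integrable_exp_re_complexGaussian (N₀ : ℝ) (w : ℂ) :
    Integrable (fun z => Real.exp ((starRingEnd ℂ) w * z).re) (complexGaussian N₀) := by
  rw [complexGaussian, integrable_map_equiv]
  have := (integrable_exp_mul_gaussianReal (μ := 0) (v := (N₀ / 2).toNNReal) w.re).mul_prod
    (integrable_exp_mul_gaussianReal (μ := 0) (v := (N₀ / 2).toNNReal) w.im)
  refine this.congr (ae_of_all _ fun p => ?_)
  simp only [Function.comp_apply, re_conj_mul, Complex.measurableEquivRealProd_symm_apply,
    Real.exp_add]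

theorem integral_exp_re_complexGaussian {N₀ : ℝ} (hN₀ : 0 < N₀) (w : ℂ) :
    ∫ z, Real.exp ((starRingEnd ℂ) w * z).re ∂(complexGaussian N₀)
      = Real.exp (N₀ / 4 * ‖w‖ ^ 2) := by
  have hmgf : ∀ t : ℝ, ∫ x, Real.exp (t * x) ∂(gaussianReal 0 (N₀ / 2).toNNReal)
      = Real.exp (N₀ / 4 * t ^ 2) := fun t => by
    have := mgf_gaussianReal (p := gaussianReal 0 (N₀ / 2).toNNReal) (X := id) (μ := 0)
      (v := (N₀ / 2).toNNReal) (by simp) t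
    simp only [mgf, id] at this
    rw [this, Real.coe_toNNReal _ (by positivity)]
    congr 1; ring
  rw [complexGaussian, integral_map_equiv]
  simp only [re_conj_mul, Complex.measurableEquivRealProd_symm_apply, Real.exp_add]
  rw [integral_prod_mul (fun x => Real.exp (w.re * x)) (fun x => Real.exp (w.im * x)), hmgf, hmgf,
    ← Real.exp_add, Complex.sq_norm, Complex.normSq_apply]
  congr 1; ring

theorem exp_re_sum_eq_prod {N : ℕ} (w y : Fin N → ℂ) :
    Real.exp (∑ k, (starRingEnd ℂ) (w k) * y k).re
      = ∏ k, Real.exp ((starRingEnd ℂ) (w k) * y k).re := by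
  rw [Complex.re_sum, Real.exp_sum]

theorem integrable_exp_re_noiseLaw (N₀ : ℝ) {N : ℕ} (w : Fin N → ℂ) :
    Integrable (fun y => Real.exp (∑ k, (starRingEnd ℂ) (w k) * y k).re) (noiseLaw N₀ N) := by
  simp only [exp_re_sum_eq_prod]
  exact Integrable.fintype_prod fun k => integrable_exp_re_complexGaussian N₀ (w k)

/-- The Laplace transform of the noise. -/
theorem integral_exp_re_noiseLaw {N₀ : ℝ} (hN₀ : 0 < N₀) {N : ℕ} (w : Fin N → ℂ) :
    ∫ y, Real.exp (∑ k, (starRingEnd ℂ) (w k) * y k).re ∂(noiseLaw N₀ N)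
      = Real.exp (N₀ / 4 * ∑ k, ‖w k‖ ^ 2) := by
  simp only [exp_re_sum_eq_prod]
  rw [noiseLaw, integral_fintype_prod_eq_prod
    (fun k (z : ℂ) => Real.exp ((starRingEnd ℂ) (w k) * z).re)]
  simp only [integral_exp_re_complexGaussian hN₀]
  rw [← Real.exp_sum, Finset.mul_sum]

/-! ### The posterior probability through the detection statistic -/

theorem re_ofReal_mul_exp_mul (c φ : ℝ) (z : ℂ) :
    ((c : ℂ) * Complex.exp (-(Complex.I * φ)) * z).re = c * ‖z‖ * Real.cos (φ - z.arg) := by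
  conv_lhs => rw [← Complex.norm_mul_exp_arg_mul_I z]
  rw [show (c : ℂ) * Complex.exp (-(Complex.I * φ)) *
      ((‖z‖ : ℂ) * Complex.exp (z.arg * Complex.I))
      = ((c * ‖z‖ : ℝ) : ℂ) * (Complex.exp (-(Complex.I * φ)) * Complex.exp (z.arg * Complex.I)) by
    push_cast; ring, ← Complex.exp_add,
    show -(Complex.I * φ) + z.arg * Complex.I = ((z.arg - φ : ℝ) : ℂ) * Complex.I by
      push_cast; ring, Complex.re_ofReal_mul, Complex.exp_ofReal_mul_I_re, ← Real.cos_neg]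
  congr 2; ring

/-- Averaging over a uniform phase produces the Bessel function: rotating `z` to the positive real
axis only shifts the phase. -/
theorem phase_average (c : ℝ) (z : ℂ) :
    1 / (2 * Real.pi) * ∫ φ in (0 : ℝ)..(2 * Real.pi),
      Real.exp ((c : ℂ) * Complex.exp (-(Complex.I * φ)) * z).re = besselI0 (c * ‖z‖) := by
  simp only [re_ofReal_mul_exp_mul, besselI0]
  congr 1
  have hper : Function.Periodic (fun φ => Real.exp (c * ‖z‖ * Real.cos φ)) (2 * Real.pi) :=
    fun φ => by simp only [Real.cos_add_two_pi]
  rw [intervalIntegral.integral_comp_sub_right (fun φ => Real.exp (c * ‖z‖ * Real.cos φ))]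
  have := hper.intervalIntegral_add_eq (0 - z.arg) 0
  rw [zero_add] at this
  rw [← this]
  congr 1; ring

theorem besselI0_zero : besselI0 0 = 1 := by
  simp only [besselI0, zero_mul, Real.exp_zero, intervalIntegral.integral_const, smul_eq_mul]
  field_simp
  ring

/-- The Bessel argument in terms of the phase amplitude `2 α / N₀`; for `α = 0` both sides vanish
thanks to `x / 0 = 0`. -/
theorem bessel_arg_eq (α N₀ v r : ℝ) : 2 * v * snr α N₀ * r / α = 2 / N₀ * (v * α) * r := by
  rcases eq_or_ne α 0 with rfl | hα
  · simp
  · rw [snr]; field_simp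

theorem channel_eq (ψ : ℝ → ℂ) (α N₀ : ℝ) (N : ℕ) (v : Fin 2) (y : Fin N → ℂ) :
    channel ψ α N₀ N v y = (1 / (Real.pi * N₀)) ^ N * Real.exp (-(1 / N₀) * ∑ k, ‖y k‖ ^ 2) *
      detectionStatistic ψ α N₀ N v y := by
  have hexp : Real.exp (-(1 / N₀) * ((∑ k, ‖y k‖ ^ 2) + (v.val : ℝ) * α ^ 2))
      = Real.exp (-(1 / N₀) * ∑ k, ‖y k‖ ^ 2) * Real.exp (-((v.val : ℝ) * snr α N₀)) := by
    rw [← Real.exp_add, snr]; congr 1; ring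
  have hre : ∀ (φ : ℝ) (z : ℂ), 2 / N₀ * ((v.val : ℂ) * (α : ℂ) *
      Complex.exp (-(Complex.I * (φ : ℂ))) * z).re
      = (((2 / N₀ * ((v.val : ℝ) * α) : ℝ) : ℂ) * Complex.exp (-(Complex.I * φ)) * z).re := by
    intro φ z
    rw [← Complex.re_ofReal_mul]
    congr 1; push_cast; ring
  simp only [channel, channelGiven, detectionStatistic, hexp, hre,
    intervalIntegral.integral_const_mul, bessel_arg_eq, ← phase_average]
  ring

theorem detectionStatistic_zero (ψ : ℝ → ℂ) (α N₀ : ℝ) {N : ℕ} (hN : 0 < N) (y : Fin N → ℂ) :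
    detectionStatistic ψ α N₀ N 0 y = 1 := by
  have hN' : (N : ℝ) ≠ 0 := by positivity
  simp only [detectionStatistic, Fin.val_zero, Nat.cast_zero, zero_mul, mul_zero, zero_div,
    besselI0_zero, neg_zero, Real.exp_zero, intervalIntegral.integral_const, smul_eq_mul]
  field_simp
  ring

theorem posterior_one_eq (prior : Fin 2 → ℝ) (ψ : ℝ → ℂ) (α : ℝ) {N₀ : ℝ} (hN₀ : 0 < N₀) {N : ℕ}
    (hN : 0 < N) (y : Fin N → ℂ) :
    posterior prior ψ α N₀ N 1 y = prior 1 * detectionStatistic ψ α N₀ N 1 y /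
      (prior 0 + prior 1 * detectionStatistic ψ α N₀ N 1 y) := by
  have hpos : (1 / (Real.pi * N₀)) ^ N * Real.exp (-(1 / N₀) * ∑ k, ‖y k‖ ^ 2) ≠ 0 := by
    have := Real.pi_pos
    positivity
  simp only [posterior, Fin.sum_univ_two, channel_eq, detectionStatistic_zero ψ α N₀ hN, mul_one]
  rw [mul_left_comm (prior 1), mul_comm (prior 0), ← mul_add, mul_div_mul_left _ _ hpos]

/-! ### The detection statistic as an average over delay and phase -/

/-- The uniform law on `(a, b]`. -/
noncomputable def uniformLaw (a b : ℝ) : Measure ℝ := cond volume (Set.Ioc a b)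

instance (a b : ℝ) : IsZeroOrProbabilityMeasure (uniformLaw a b) :=
  inferInstanceAs (IsZeroOrProbabilityMeasure (cond volume (Set.Ioc a b)))

theorem isProbabilityMeasure_uniformLaw {a b : ℝ} (hab : a < b) :
    IsProbabilityMeasure (uniformLaw a b) :=
  cond_isProbabilityMeasure_of_finite (by simp [hab]) (by simp)

theorem integral_uniformLaw {a b : ℝ} (hab : a ≤ b) (f : ℝ → ℝ) :
    ∫ x, f x ∂(uniformLaw a b) = 1 / (b - a) * ∫ x in a..b, f x := by
  rw [uniformLaw, ProbabilityTheory.cond, integral_smul_measure,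
    intervalIntegral.integral_of_le hab, Real.volume_Ioc, ENNReal.toReal_inv,
    ENNReal.toReal_ofReal (sub_nonneg.2 hab), smul_eq_mul, one_div]

/-- The joint law of the delay, uniform on the observation interval, and of the independent
uniform phase. Closing the intervals on the right instead of the left changes null sets only. -/
noncomputable def delayPhaseLaw (N : ℕ) : Measure (ℝ × ℝ) :=
  (uniformLaw (-(N : ℝ) / 2) (N / 2)).prod (uniformLaw 0 (2 * Real.pi))

theorem isProbabilityMeasure_delayLaw {N : ℕ} (hN : 0 < N) :
    IsProbabilityMeasure (uniformLaw (-(N : ℝ) / 2) (N / 2)) :=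
  isProbabilityMeasure_uniformLaw (by
    have : (0 : ℝ) < N := by exact_mod_cast hN
    linarith)

theorem isProbabilityMeasure_delayPhaseLaw {N : ℕ} (hN : 0 < N) :
    IsProbabilityMeasure (delayPhaseLaw N) := by
  have := isProbabilityMeasure_delayLaw hN
  have := isProbabilityMeasure_uniformLaw (show (0 : ℝ) < 2 * Real.pi by positivity)
  rw [delayPhaseLaw]
  infer_instance

theorem integral_delayLaw (N : ℕ) (f : ℝ → ℝ) :
    ∫ x, f x ∂(uniformLaw (-(N : ℝ) / 2) (N / 2))
      = 1 / (N : ℝ) * ∫ x in (-(N : ℝ) / 2)..((N : ℝ) / 2), f x := by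
  rw [integral_uniformLaw (by linarith [N.cast_nonneg (α := ℝ)])]
  congr 2; ring

/-- Averages of functions of the delay alone. -/
theorem integral_delayPhaseLaw_fst (N : ℕ) (f : ℝ → ℝ) :
    ∫ θ, f θ.1 ∂(delayPhaseLaw N)
      = 1 / (N : ℝ) * ∫ x in (-(N : ℝ) / 2)..((N : ℝ) / 2), f x := by
  have := isProbabilityMeasure_uniformLaw (show (0 : ℝ) < 2 * Real.pi by positivity)
  rw [delayPhaseLaw, integral_fun_fst, probReal_univ, one_smul, integral_delayLaw]

/-- The weights `(2 α / N₀) exp (i φ) u(x)` of the matched filter tuned to the delay `x` and the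
phase `φ`, scaled as they enter the likelihood. -/
noncomputable def filterWeights (ψ : ℝ → ℂ) (α N₀ : ℝ) (N : ℕ) (θ : ℝ × ℝ) (k : Fin N) : ℂ :=
  ((2 / N₀ * α : ℝ) : ℂ) * Complex.exp (Complex.I * θ.2) * waveform ψ N θ.1 k

/-- The likelihood ratio of the hypothesis of a target of known delay and phase against noise. -/
noncomputable def likelihoodRatio (ψ : ℝ → ℂ) (α N₀ : ℝ) (N : ℕ) (y : Fin N → ℂ) (θ : ℝ × ℝ) : ℝ :=
  Real.exp (-snr α N₀) *
    Real.exp (∑ k, (starRingEnd ℂ) (filterWeights ψ α N₀ N θ k) * y k).re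

theorem likelihoodRatio_pos (ψ : ℝ → ℂ) (α N₀ : ℝ) (N : ℕ) (y : Fin N → ℂ) (θ : ℝ × ℝ) :
    0 < likelihoodRatio ψ α N₀ N y θ := by
  unfold likelihoodRatio; positivity

theorem sum_conj_filterWeights_mul (ψ : ℝ → ℂ) (α N₀ : ℝ) (N : ℕ) (θ : ℝ × ℝ) (y : Fin N → ℂ) :
    ∑ k, (starRingEnd ℂ) (filterWeights ψ α N₀ N θ k) * y k
      = ((2 / N₀ * α : ℝ) : ℂ) * Complex.exp (-(Complex.I * θ.2)) * matchedFilter ψ N y θ.1 := by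
  rw [matchedFilter, Finset.mul_sum]
  refine Finset.sum_congr rfl fun k _ => ?_
  simp only [filterWeights, map_mul, Complex.conj_ofReal, ← Complex.exp_conj, Complex.conj_I]
  rw [neg_mul]
  ring

theorem norm_filterWeights (ψ : ℝ → ℂ) (α N₀ : ℝ) (N : ℕ) (θ : ℝ × ℝ) (k : Fin N) :
    ‖filterWeights ψ α N₀ N θ k‖ = |2 / N₀ * α| * ‖waveform ψ N θ.1 k‖ := by
  rw [filterWeights, norm_mul, norm_mul, Complex.norm_real, Complex.norm_exp_I_mul_ofReal,
    mul_one, Real.norm_eq_abs]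

theorem continuous_waveform {ψ : ℝ → ℂ} (hψ : Continuous ψ) (N : ℕ) (k : Fin N) :
    Continuous fun x => waveform ψ N x k :=
  hψ.comp (continuous_const.sub continuous_id)

theorem continuous_likelihoodRatio {ψ : ℝ → ℂ} (hψ : Continuous ψ) (α N₀ : ℝ) (N : ℕ) :
    Continuous fun p : (Fin N → ℂ) × (ℝ × ℝ) => likelihoodRatio ψ α N₀ N p.1 p.2 := by
  have hw : ∀ k : Fin N, Continuous fun p : (Fin N → ℂ) × (ℝ × ℝ) => waveform ψ N p.2.1 k :=
    fun k => (continuous_waveform hψ N k).comp (by fun_prop)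
  have hexp : Continuous fun p : (Fin N → ℂ) × (ℝ × ℝ) => Complex.exp (Complex.I * p.2.2) := by
    fun_prop
  have hf : ∀ k : Fin N, Continuous fun p : (Fin N → ℂ) × (ℝ × ℝ) =>
      (starRingEnd ℂ) (filterWeights ψ α N₀ N p.2 k) * p.1 k := fun k => by
    have hy : Continuous fun p : (Fin N → ℂ) × (ℝ × ℝ) => p.1 k := by fun_prop
    unfold filterWeights
    exact (Complex.continuous_conj.comp ((continuous_const.mul hexp).mul (hw k))).mul hy
  have hsum : Continuous fun p : (Fin N → ℂ) × (ℝ × ℝ) =>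
      ∑ k, (starRingEnd ℂ) (filterWeights ψ α N₀ N p.2 k) * p.1 k :=
    continuous_finsetSum _ fun k _ => hf k
  unfold likelihoodRatio
  exact continuous_const.mul (Real.continuous_exp.comp (Complex.continuous_re.comp hsum))

theorem integrable_likelihoodRatio_delayPhaseLaw {ψ : ℝ → ℂ} (hψ : IsBasebandPulse ψ) (α N₀ : ℝ)
    {N : ℕ} (hN : 0 < N) (y : Fin N → ℂ) :
    Integrable (likelihoodRatio ψ α N₀ N y) (delayPhaseLaw N) := by
  have := isProbabilityMeasure_delayPhaseLaw hN
  have hc : Continuous fun θ => likelihoodRatio ψ α N₀ N y θ :=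
    (continuous_likelihoodRatio hψ.continuous α N₀ N).comp₂ continuous_const continuous_id
  refine Integrable.of_bound hc.aestronglyMeasurable
    (Real.exp (-snr α N₀) * Real.exp (∑ k, |2 / N₀ * α| * ‖y k‖)) (ae_of_all _ fun θ => ?_)
  rw [Real.norm_of_nonneg (likelihoodRatio_pos _ _ _ _ _ _).le, likelihoodRatio]
  gcongr
  refine (Complex.re_le_norm _).trans ((norm_sum_le _ _).trans (Finset.sum_le_sum fun k _ => ?_))
  have hk : ‖waveform ψ N θ.1 k‖ ^ 2 ≤ 1 :=
    (Finset.single_le_sum (f := fun k => ‖waveform ψ N θ.1 k‖ ^ 2) (fun _ _ => by positivity)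
      (Finset.mem_univ k)).trans (hψ.sum_norm_sq_waveform_le_one N θ.1)
  have hk' : ‖waveform ψ N θ.1 k‖ ≤ 1 := by
    nlinarith [norm_nonneg (waveform ψ N θ.1 k)]
  rw [norm_mul, RCLike.norm_conj, norm_filterWeights]
  gcongr
  exact mul_le_of_le_one_right (abs_nonneg _) hk'

theorem detectionStatistic_one_eq_integral {ψ : ℝ → ℂ} (hψ : IsBasebandPulse ψ) (α N₀ : ℝ)
    {N : ℕ} (hN : 0 < N) (y : Fin N → ℂ) :
    detectionStatistic ψ α N₀ N 1 y = ∫ θ, likelihoodRatio ψ α N₀ N y θ ∂(delayPhaseLaw N) := by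
  have := isProbabilityMeasure_delayLaw hN
  have := isProbabilityMeasure_uniformLaw (show (0 : ℝ) < 2 * Real.pi by positivity)
  have hint := integrable_likelihoodRatio_delayPhaseLaw hψ α N₀ hN y
  rw [delayPhaseLaw] at hint ⊢
  rw [integral_prod _ hint]
  simp only [integral_delayLaw, integral_uniformLaw (show (0 : ℝ) ≤ 2 * Real.pi by positivity),
    likelihoodRatio, sum_conj_filterWeights_mul, sub_zero, intervalIntegral.integral_const_mul,
    mul_left_comm (1 / (2 * Real.pi)), phase_average, detectionStatistic, bessel_arg_eq]
  simp only [Fin.val_one, Nat.cast_one, one_mul]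
  ring

theorem detectionStatistic_one_pos {ψ : ℝ → ℂ} (hψ : IsBasebandPulse ψ) (α N₀ : ℝ)
    {N : ℕ} (hN : 0 < N) (y : Fin N → ℂ) : 0 < detectionStatistic ψ α N₀ N 1 y := by
  have := isProbabilityMeasure_delayPhaseLaw hN
  rw [detectionStatistic_one_eq_integral hψ α N₀ hN, integral_pos_iff_support_of_nonneg
    (fun θ => (likelihoodRatio_pos _ _ _ _ _ _).le)
    (integrable_likelihoodRatio_delayPhaseLaw hψ α N₀ hN y)]
  have : Function.support (likelihoodRatio ψ α N₀ N y) = Set.univ :=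
    Set.eq_univ_of_forall fun θ => (likelihoodRatio_pos _ _ _ _ _ _).ne'
  rw [this, measure_univ]
  exact one_pos

/-! ### Moments of the detection statistic -/

variable {ψ : ℝ → ℂ} {α N₀ : ℝ} {N : ℕ}

theorem filterWeights_gain (hN₀ : 0 < N₀) : N₀ / 4 * (2 / N₀ * α) ^ 2 = snr α N₀ := by
  rw [snr]; field_simp; ring

theorem integral_likelihoodRatio (hN₀ : 0 < N₀) (θ : ℝ × ℝ) :
    ∫ y, likelihoodRatio ψ α N₀ N y θ ∂(noiseLaw N₀ N)
      = Real.exp (snr α N₀ * (∑ k, ‖waveform ψ N θ.1 k‖ ^ 2 - 1)) := by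
  simp only [likelihoodRatio]
  rw [integral_const_mul, integral_exp_re_noiseLaw hN₀, ← Real.exp_add]
  simp only [norm_filterWeights, mul_pow, sq_abs]
  rw [← Finset.mul_sum, ← mul_assoc, ← mul_pow, filterWeights_gain hN₀]
  congr 1; ring

theorem integrable_likelihoodRatio_noiseLaw (θ : ℝ × ℝ) :
    Integrable (fun y => likelihoodRatio ψ α N₀ N y θ) (noiseLaw N₀ N) :=
  (integrable_exp_re_noiseLaw N₀ _).const_mul _

theorem likelihoodRatio_mul (y : Fin N → ℂ) (θ θ' : ℝ × ℝ) :
    likelihoodRatio ψ α N₀ N y θ * likelihoodRatio ψ α N₀ N y θ' = Real.exp (-(2 * snr α N₀)) *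
      Real.exp (∑ k, (starRingEnd ℂ)
        (filterWeights ψ α N₀ N θ k + filterWeights ψ α N₀ N θ' k) * y k).re := by
  simp only [likelihoodRatio, map_add, add_mul, Finset.sum_add_distrib, Complex.add_re,
    ← Real.exp_add]
  congr 1; ring

theorem integrable_likelihoodRatio_mul (θ θ' : ℝ × ℝ) :
    Integrable (fun y => likelihoodRatio ψ α N₀ N y θ * likelihoodRatio ψ α N₀ N y θ')
      (noiseLaw N₀ N) := by
  simp only [likelihoodRatio_mul]
  exact (integrable_exp_re_noiseLaw N₀ _).const_mul _

/-- The overlap of the moduli of two delayed waveforms. -/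
noncomputable def overlap (ψ : ℝ → ℂ) (N : ℕ) (x x' : ℝ) : ℝ :=
  ∑ k, ‖waveform ψ N x k‖ * ‖waveform ψ N x' k‖

theorem overlap_nonneg (x x' : ℝ) : 0 ≤ overlap ψ N x x' :=
  Finset.sum_nonneg fun _ _ => by positivity

theorem overlap_le_one (hψ : IsBasebandPulse ψ) (x x' : ℝ) : overlap ψ N x x' ≤ 1 := by
  have h : overlap ψ N x x'
      ≤ ∑ k, (‖waveform ψ N x k‖ ^ 2 / 2 + ‖waveform ψ N x' k‖ ^ 2 / 2) :=
    Finset.sum_le_sum fun k _ => by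
      nlinarith [sq_nonneg (‖waveform ψ N x k‖ - ‖waveform ψ N x' k‖)]
  rw [Finset.sum_add_distrib, ← Finset.sum_div, ← Finset.sum_div] at h
  linarith [hψ.sum_norm_sq_waveform_le_one N x, hψ.sum_norm_sq_waveform_le_one N x']

/-- The likelihood ratios of two targets are almost uncorrelated under noise when their waveforms
hardly overlap. -/
theorem integral_likelihoodRatio_mul_le (hψ : IsBasebandPulse ψ) (hN₀ : 0 < N₀) (θ θ' : ℝ × ℝ) :
    ∫ y, likelihoodRatio ψ α N₀ N y θ * likelihoodRatio ψ α N₀ N y θ' ∂(noiseLaw N₀ N)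
      ≤ 1 + (Real.exp (2 * snr α N₀) - 1) * overlap ψ N θ.1 θ'.1 := by
  have hsnr : 0 ≤ snr α N₀ := by unfold snr; positivity
  set r := overlap ψ N θ.1 θ'.1 with hr
  have hr0 : 0 ≤ r := overlap_nonneg _ _
  have hr1 : r ≤ 1 := overlap_le_one hψ _ _
  have hsum : ∑ k, ‖filterWeights ψ α N₀ N θ k + filterWeights ψ α N₀ N θ' k‖ ^ 2
      ≤ (2 / N₀ * α) ^ 2 * (2 + 2 * r) := by
    calc ∑ k, ‖filterWeights ψ α N₀ N θ k + filterWeights ψ α N₀ N θ' k‖ ^ 2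
        ≤ ∑ k, (‖filterWeights ψ α N₀ N θ k‖ + ‖filterWeights ψ α N₀ N θ' k‖) ^ 2 := by
          gcongr; exact norm_add_le _ _
      _ = (2 / N₀ * α) ^ 2 * (∑ k, ‖waveform ψ N θ.1 k‖ ^ 2
          + ∑ k, ‖waveform ψ N θ'.1 k‖ ^ 2 + 2 * r) := by
          rw [hr, overlap, Finset.mul_sum, ← Finset.sum_add_distrib, ← Finset.sum_add_distrib,
            Finset.mul_sum]
          refine Finset.sum_congr rfl fun k _ => ?_
          rw [norm_filterWeights, norm_filterWeights, ← mul_add, mul_pow, sq_abs]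
          ring
      _ ≤ _ := by
          gcongr
          linarith [hψ.sum_norm_sq_waveform_le_one N θ.1, hψ.sum_norm_sq_waveform_le_one N θ'.1]
  simp only [likelihoodRatio_mul]
  rw [integral_const_mul, integral_exp_re_noiseLaw hN₀, ← Real.exp_add]
  have hle : -(2 * snr α N₀) + N₀ / 4 *
      ∑ k, ‖filterWeights ψ α N₀ N θ k + filterWeights ψ α N₀ N θ' k‖ ^ 2
      ≤ 2 * snr α N₀ * r := by
    have := mul_le_mul_of_nonneg_left hsum (show 0 ≤ N₀ / 4 by positivity)
    rw [← mul_assoc, filterWeights_gain hN₀] at this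
    linarith
  refine (Real.exp_le_exp.2 hle).trans ?_
  have hconv := convexOn_exp.2 (Set.mem_univ (0 : ℝ)) (Set.mem_univ (2 * snr α N₀))
    (sub_nonneg.2 hr1) hr0 (by ring)
  simp only [smul_eq_mul, mul_zero, zero_add, Real.exp_zero, mul_one] at hconv
  rw [mul_comm (2 * snr α N₀)]
  linarith

/-- Tonelli's criterion for a nonnegative kernel with bounded means. -/
theorem integrable_prod_of_nonneg_of_integral_le {Y Θ : Type*} [MeasurableSpace Y]
    [MeasurableSpace Θ] {μ : Measure Y} {P : Measure Θ} [SFinite μ] [IsFiniteMeasure P]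
    {F : Y × Θ → ℝ} (hF : AEStronglyMeasurable F (μ.prod P)) (h0 : ∀ z, 0 ≤ F z)
    (hint : ∀ θ, Integrable (fun y => F (y, θ)) μ) {C : ℝ} (hC : ∀ θ, ∫ y, F (y, θ) ∂μ ≤ C) :
    Integrable F (μ.prod P) := by
  rw [integrable_prod_iff' hF]
  refine ⟨ae_of_all _ hint, ?_⟩
  refine Integrable.of_bound hF.norm.prod_swap.integral_prod_right' C (ae_of_all _ fun θ => ?_)
  simp only [Real.norm_of_nonneg (h0 _)]
  rw [Real.norm_of_nonneg (integral_nonneg fun y => h0 _)]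
  exact hC θ

theorem integrable_likelihoodRatio_prod (hψ : IsBasebandPulse ψ) (hN₀ : 0 < N₀) (hN : 0 < N) :
    Integrable (fun p : (Fin N → ℂ) × (ℝ × ℝ) => likelihoodRatio ψ α N₀ N p.1 p.2)
      ((noiseLaw N₀ N).prod (delayPhaseLaw N)) := by
  have := isProbabilityMeasure_delayPhaseLaw hN
  refine integrable_prod_of_nonneg_of_integral_le
    (continuous_likelihoodRatio hψ.continuous α N₀ N).aestronglyMeasurable
    (fun _ => (likelihoodRatio_pos _ _ _ _ _ _).le)
    (fun θ => integrable_likelihoodRatio_noiseLaw θ) (C := 1) fun θ => ?_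
  have hsnr : 0 ≤ snr α N₀ := by unfold snr; positivity
  rw [integral_likelihoodRatio hN₀, Real.exp_le_one_iff]
  exact mul_nonpos_of_nonneg_of_nonpos hsnr
    (sub_nonpos.2 (hψ.sum_norm_sq_waveform_le_one N θ.1))

theorem integrable_likelihoodRatio_mul_prod (hψ : IsBasebandPulse ψ) (hN₀ : 0 < N₀) (hN : 0 < N) :
    Integrable (fun p : (Fin N → ℂ) × ((ℝ × ℝ) × (ℝ × ℝ)) =>
      likelihoodRatio ψ α N₀ N p.1 p.2.1 * likelihoodRatio ψ α N₀ N p.1 p.2.2)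
      ((noiseLaw N₀ N).prod ((delayPhaseLaw N).prod (delayPhaseLaw N))) := by
  have := isProbabilityMeasure_delayPhaseLaw hN
  have hc := continuous_likelihoodRatio hψ.continuous α N₀ N
  have hsnr : 0 ≤ snr α N₀ := by unfold snr; positivity
  have hc1 : Continuous fun p : (Fin N → ℂ) × ((ℝ × ℝ) × (ℝ × ℝ)) =>
      likelihoodRatio ψ α N₀ N p.1 p.2.1 :=
    hc.comp₂ continuous_fst (continuous_fst.comp continuous_snd)
  have hc2 : Continuous fun p : (Fin N → ℂ) × ((ℝ × ℝ) × (ℝ × ℝ)) =>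
      likelihoodRatio ψ α N₀ N p.1 p.2.2 :=
    hc.comp₂ continuous_fst (continuous_snd.comp continuous_snd)
  have hc12 : Continuous fun p : (Fin N → ℂ) × ((ℝ × ℝ) × (ℝ × ℝ)) =>
      likelihoodRatio ψ α N₀ N p.1 p.2.1 * likelihoodRatio ψ α N₀ N p.1 p.2.2 := hc1.mul hc2
  refine integrable_prod_of_nonneg_of_integral_le hc12.aestronglyMeasurable
    (fun _ => mul_nonneg (likelihoodRatio_pos _ _ _ _ _ _).le (likelihoodRatio_pos _ _ _ _ _ _).le)
    (fun θ => integrable_likelihoodRatio_mul θ.1 θ.2)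
    (C := 1 + (Real.exp (2 * snr α N₀) - 1) * 1) fun θ => ?_
  refine (integral_likelihoodRatio_mul_le hψ hN₀ θ.1 θ.2).trans ?_
  gcongr
  · exact sub_nonneg.2 (Real.one_le_exp (by positivity))
  · exact overlap_le_one hψ _ _

theorem integrable_detectionStatistic (hψ : IsBasebandPulse ψ) (hN₀ : 0 < N₀) (hN : 0 < N) :
    Integrable (detectionStatistic ψ α N₀ N 1) (noiseLaw N₀ N) := by
  have := isProbabilityMeasure_delayPhaseLaw hN
  rw [show detectionStatistic ψ α N₀ N 1 = _ from
    funext (detectionStatistic_one_eq_integral hψ α N₀ hN)]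
  exact (integrable_likelihoodRatio_prod hψ hN₀ hN).integral_prod_left

theorem detectionStatistic_one_sq_eq_integral (hψ : IsBasebandPulse ψ) (hN : 0 < N)
    (y : Fin N → ℂ) :
    detectionStatistic ψ α N₀ N 1 y ^ 2 = ∫ θ : (ℝ × ℝ) × (ℝ × ℝ),
      likelihoodRatio ψ α N₀ N y θ.1 * likelihoodRatio ψ α N₀ N y θ.2
      ∂((delayPhaseLaw N).prod (delayPhaseLaw N)) := by
  have := isProbabilityMeasure_delayPhaseLaw hN
  rw [integral_prod_mul, detectionStatistic_one_eq_integral hψ α N₀ hN, sq]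

theorem integrable_detectionStatistic_sq (hψ : IsBasebandPulse ψ) (hN₀ : 0 < N₀) (hN : 0 < N) :
    Integrable (fun y => detectionStatistic ψ α N₀ N 1 y ^ 2) (noiseLaw N₀ N) := by
  have := isProbabilityMeasure_delayPhaseLaw hN
  simp only [detectionStatistic_one_sq_eq_integral hψ hN]
  exact (integrable_likelihoodRatio_mul_prod hψ hN₀ hN).integral_prod_left

theorem intervalIntegral_comp_sampleTime_sub (f : ℝ → ℝ) (k : Fin N) :
    ∫ x in (-(N : ℝ) / 2)..((N : ℝ) / 2), f (sampleTime N k - x)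
      = ∫ t in ((k : ℝ) - N)..k, f t := by
  rw [intervalIntegral.integral_comp_sub_left]
  congr 1 <;> rw [sampleTime] <;> ring

theorem le_integral_detectionStatistic (hψ : IsBasebandPulse ψ) (hN₀ : 0 < N₀) (hN : 0 < N) :
    1 + snr α N₀ * (1 / (N : ℝ) * (∑ k : Fin N, ∫ t in ((k : ℝ) - N)..k, ‖ψ t‖ ^ 2) - 1)
      ≤ ∫ y, detectionStatistic ψ α N₀ N 1 y ∂(noiseLaw N₀ N) := by
  have := isProbabilityMeasure_delayPhaseLaw hN
  have hcont : Continuous fun θ : ℝ × ℝ => ∑ k, ‖waveform ψ N θ.1 k‖ ^ 2 :=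
    continuous_finsetSum _ fun k _ =>
      ((continuous_waveform hψ.continuous N k).comp continuous_fst).norm.pow 2
  have hint : Integrable (fun θ : ℝ × ℝ => ∑ k, ‖waveform ψ N θ.1 k‖ ^ 2) (delayPhaseLaw N) := by
    refine Integrable.of_bound hcont.aestronglyMeasurable 1 (ae_of_all _ fun θ => ?_)
    rw [Real.norm_of_nonneg (Finset.sum_nonneg fun _ _ => by positivity)]
    exact hψ.sum_norm_sq_waveform_le_one N θ.1
  have hmean : ∫ θ : ℝ × ℝ, ∑ k, ‖waveform ψ N θ.1 k‖ ^ 2 ∂(delayPhaseLaw N)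
      = 1 / (N : ℝ) * ∑ k : Fin N, ∫ t in ((k : ℝ) - N)..k, ‖ψ t‖ ^ 2 := by
    have hk : ∀ k : Fin N, Continuous fun x => ‖waveform ψ N x k‖ ^ 2 := fun k =>
      (continuous_waveform hψ.continuous N k).norm.pow 2
    rw [integral_delayPhaseLaw_fst N (fun x => ∑ k, ‖waveform ψ N x k‖ ^ 2),
      intervalIntegral.integral_finsetSum fun k _ => (hk k).intervalIntegrable _ _]
    simp only [waveform, intervalIntegral_comp_sampleTime_sub (fun t => ‖ψ t‖ ^ 2)]
  have hdev : Integrable (fun θ : ℝ × ℝ => snr α N₀ * (∑ k, ‖waveform ψ N θ.1 k‖ ^ 2 - 1))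
      (delayPhaseLaw N) := (hint.sub (integrable_const _)).const_mul _
  have hprod := integrable_likelihoodRatio_prod (α := α) hψ hN₀ hN
  simp only [detectionStatistic_one_eq_integral hψ α N₀ hN]
  rw [integral_integral_swap hprod, ← hmean]
  have hlin : 1 + snr α N₀ * ((∫ θ : ℝ × ℝ, ∑ k, ‖waveform ψ N θ.1 k‖ ^ 2 ∂(delayPhaseLaw N)) - 1)
      = ∫ θ : ℝ × ℝ, (1 + snr α N₀ * (∑ k, ‖waveform ψ N θ.1 k‖ ^ 2 - 1)) ∂(delayPhaseLaw N) := by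
    rw [integral_add (integrable_const _) hdev,
      integral_const_mul, integral_sub hint (integrable_const _)]
    simp
  rw [hlin]
  refine integral_mono ((integrable_const _).add hdev) hprod.integral_prod_right fun θ => ?_
  simp only [integral_likelihoodRatio hN₀]
  rw [add_comm]
  exact Real.add_one_le_exp _

theorem continuous_overlap (hψ : IsBasebandPulse ψ) :
    Continuous fun θ : (ℝ × ℝ) × (ℝ × ℝ) => overlap ψ N θ.1.1 θ.2.1 :=
  continuous_finsetSum _ fun k _ =>
    (((continuous_waveform hψ.continuous N k).comp (continuous_fst.comp continuous_fst)).norm).mul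
      (((continuous_waveform hψ.continuous N k).comp (continuous_fst.comp continuous_snd)).norm)

theorem integrable_overlap (hψ : IsBasebandPulse ψ) (hN : 0 < N) :
    Integrable (fun θ : (ℝ × ℝ) × (ℝ × ℝ) => overlap ψ N θ.1.1 θ.2.1)
      ((delayPhaseLaw N).prod (delayPhaseLaw N)) := by
  have := isProbabilityMeasure_delayPhaseLaw hN
  refine Integrable.of_bound (continuous_overlap hψ).aestronglyMeasurable 1 (ae_of_all _ fun θ => ?_)
  rw [Real.norm_of_nonneg (overlap_nonneg _ _)]
  exact overlap_le_one hψ _ _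

/-- The average overlap of two independently delayed waveforms: the two delays separate in each of
its terms. -/
theorem integral_overlap_le (hψ : IsBasebandPulse ψ) (hN : 0 < N) :
    ∫ θ : (ℝ × ℝ) × (ℝ × ℝ), overlap ψ N θ.1.1 θ.2.1 ∂((delayPhaseLaw N).prod (delayPhaseLaw N))
      ≤ (∫ t in (-(N : ℝ))..N, ‖ψ t‖) ^ 2 / N := by
  have := isProbabilityMeasure_delayPhaseLaw hN
  have hN' : (0 : ℝ) < N := by exact_mod_cast hN
  have hwint : ∀ k : Fin N, Integrable (fun θ : ℝ × ℝ => ‖waveform ψ N θ.1 k‖)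
      (delayPhaseLaw N) := fun k => by
    refine Integrable.of_bound
      ((continuous_waveform hψ.continuous N k).comp continuous_fst).norm.aestronglyMeasurable 1
      (ae_of_all _ fun θ => ?_)
    have h := (Finset.single_le_sum (f := fun k => ‖waveform ψ N θ.1 k‖ ^ 2)
      (fun _ _ => by positivity) (Finset.mem_univ k)).trans
      (hψ.sum_norm_sq_waveform_le_one N θ.1)
    rw [norm_norm]
    exact (sq_le_one_iff₀ (norm_nonneg _)).1 h
  have hwmean : ∀ k : Fin N, ∫ θ : ℝ × ℝ, ‖waveform ψ N θ.1 k‖ ∂(delayPhaseLaw N)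
      ≤ 1 / (N : ℝ) * ∫ t in (-(N : ℝ))..N, ‖ψ t‖ := fun k => by
    have hk : ((k : ℕ) : ℝ) ≤ N := by exact_mod_cast k.2.le
    rw [integral_delayPhaseLaw_fst N (fun x => ‖waveform ψ N x k‖)]
    simp only [waveform, intervalIntegral_comp_sampleTime_sub (fun t => ‖ψ t‖)]
    gcongr
    exact intervalIntegral.integral_mono_interval (by linarith [(k : ℕ).cast_nonneg (α := ℝ)])
      (by linarith) hk (ae_of_all _ fun _ => norm_nonneg _) (hψ.intervalIntegrable_norm _ _)
  unfold overlap
  rw [integral_finsetSum _ fun k _ => (hwint k).mul_prod (hwint k)]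
  calc ∑ k, ∫ θ : (ℝ × ℝ) × (ℝ × ℝ), ‖waveform ψ N θ.1.1 k‖ * ‖waveform ψ N θ.2.1 k‖
        ∂((delayPhaseLaw N).prod (delayPhaseLaw N))
      = ∑ k, (∫ θ : ℝ × ℝ, ‖waveform ψ N θ.1 k‖ ∂(delayPhaseLaw N)) ^ 2 :=
        Finset.sum_congr rfl fun k _ => by
          rw [integral_prod_mul (fun θ : ℝ × ℝ => ‖waveform ψ N θ.1 k‖)
            (fun θ : ℝ × ℝ => ‖waveform ψ N θ.1 k‖), sq]
    _ ≤ ∑ _k : Fin N, (1 / (N : ℝ) * ∫ t in (-(N : ℝ))..N, ‖ψ t‖) ^ 2 :=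
        Finset.sum_le_sum fun k _ =>
          pow_le_pow_left₀ (integral_nonneg fun _ => norm_nonneg _) (hwmean k) 2
    _ = _ := by
        rw [Finset.sum_const, Finset.card_univ, Fintype.card_fin, nsmul_eq_mul]
        field_simp

theorem integral_detectionStatistic_sq_le (hψ : IsBasebandPulse ψ) (hN₀ : 0 < N₀) (hN : 0 < N) :
    ∫ y, detectionStatistic ψ α N₀ N 1 y ^ 2 ∂(noiseLaw N₀ N)
      ≤ 1 + (Real.exp (2 * snr α N₀) - 1) * ((∫ t in (-(N : ℝ))..N, ‖ψ t‖) ^ 2 / N) := by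
  have := isProbabilityMeasure_delayPhaseLaw hN
  have hsnr : 0 ≤ snr α N₀ := by unfold snr; positivity
  have hC : 0 ≤ Real.exp (2 * snr α N₀) - 1 := sub_nonneg.2 (Real.one_le_exp (by positivity))
  have hprod := integrable_likelihoodRatio_mul_prod (α := α) hψ hN₀ hN
  have hover := integrable_overlap hψ hN
  simp only [detectionStatistic_one_sq_eq_integral hψ hN]
  rw [integral_integral_swap hprod]
  calc _ ≤ ∫ θ : (ℝ × ℝ) × (ℝ × ℝ), (1 + (Real.exp (2 * snr α N₀) - 1) *
        overlap ψ N θ.1.1 θ.2.1) ∂((delayPhaseLaw N).prod (delayPhaseLaw N)) :=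
        integral_mono hprod.integral_prod_right ((integrable_const _).add (hover.const_mul _))
          fun θ => integral_likelihoodRatio_mul_le hψ hN₀ θ.1 θ.2
    _ = 1 + (Real.exp (2 * snr α N₀) - 1) * ∫ θ : (ℝ × ℝ) × (ℝ × ℝ), overlap ψ N θ.1.1 θ.2.1
        ∂((delayPhaseLaw N).prod (delayPhaseLaw N)) := by
        rw [integral_add (integrable_const _) (hover.const_mul _), integral_const_mul]
        simp
    _ ≤ _ := by
        gcongr
        exact integral_overlap_le hψ hN

/-- Under noise the detection statistic converges to one in quadratic mean. -/
theorem tendsto_integral_detectionStatistic_sub_one_sq (hψ : IsBasebandPulse ψ) (hN₀ : 0 < N₀) :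
    Tendsto (fun N : ℕ => ∫ y, (detectionStatistic ψ α N₀ N 1 y - 1) ^ 2 ∂(noiseLaw N₀ N))
      atTop (𝓝 0) := by
  have h1 := hψ.tendsto_sq_intervalIntegral_norm_div.const_mul (Real.exp (2 * snr α N₀) - 1)
  have h2 := (tendsto_const_nhds (x := (1 : ℝ)).sub
    hψ.tendsto_mean_intervalIntegral_norm_sq).const_mul (2 * snr α N₀)
  have hlim := h1.add h2
  rw [sub_self, mul_zero, mul_zero, add_zero] at hlim
  refine tendsto_of_tendsto_of_tendsto_of_le_of_le' tendsto_const_nhds hlim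
    (Eventually.of_forall fun N => integral_nonneg fun y => sq_nonneg _) ?_
  filter_upwards [eventually_gt_atTop 0] with N hN
  have hi1 := integrable_detectionStatistic (α := α) hψ hN₀ hN
  have hi2 := integrable_detectionStatistic_sq (α := α) hψ hN₀ hN
  have hexpand : ∫ y, (detectionStatistic ψ α N₀ N 1 y - 1) ^ 2 ∂(noiseLaw N₀ N)
      = (∫ y, detectionStatistic ψ α N₀ N 1 y ^ 2 ∂(noiseLaw N₀ N))
        - 2 * (∫ y, detectionStatistic ψ α N₀ N 1 y ∂(noiseLaw N₀ N)) + 1 := by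
    have : ∀ y : Fin N → ℂ, (detectionStatistic ψ α N₀ N 1 y - 1) ^ 2
        = detectionStatistic ψ α N₀ N 1 y ^ 2 - 2 * detectionStatistic ψ α N₀ N 1 y + 1 :=
      fun y => by ring
    have hi : Integrable (fun y : Fin N → ℂ => detectionStatistic ψ α N₀ N 1 y ^ 2
        - 2 * detectionStatistic ψ α N₀ N 1 y) (noiseLaw N₀ N) := hi2.sub (hi1.const_mul 2)
    simp only [this]
    rw [integral_add hi (integrable_const _),
      integral_sub hi2 (hi1.const_mul 2), integral_const_mul]
    simp
  rw [hexpand]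
  linarith [integral_detectionStatistic_sq_le (α := α) hψ hN₀ hN,
    le_integral_detectionStatistic (α := α) hψ hN₀ hN]

/-! ### The false alarm probability -/

/-- Replacing the detection statistic by one changes the posterior probability at most
proportionally. -/
theorem abs_posterior_sub_le {p q u : ℝ} (hp : 0 ≤ p) (hq : 0 ≤ q) (hpq : p + q = 1) (hu : 0 < u) :
    |q * u / (p + q * u) - q| ≤ |u - 1| := by
  have hd : 0 < p + q * u := by
    rcases hp.eq_or_lt with rfl | hp'
    · have : q = 1 := by linarith
      rw [this]; linarith
    · positivity
  have heq : q * u / (p + q * u) - q = q * (p / (p + q * u)) * (u - 1) := by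
    have : p = 1 - q := by linarith
    subst this
    field_simp
    ring
  rw [heq, abs_mul]
  refine mul_le_of_le_one_left (abs_nonneg _) ?_
  have h1 : p / (p + q * u) ≤ 1 := (div_le_one hd).2 (by linarith [mul_nonneg hq hu.le])
  rw [abs_of_nonneg (by positivity)]
  exact mul_le_one₀ (by linarith) (by positivity) h1

end Radar

theorem theorem1 (ψ : ℝ → ℂ) (hψ : Radar.IsBasebandPulse ψ)
    (α N₀ : ℝ) (hα : 0 ≤ α) (hN₀ : 0 < N₀)
    (prior : Fin 2 → ℝ) (hprior : ∀ v, 0 ≤ prior v) (hsum : prior 0 + prior 1 = 1) :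
    (∀ N : ℕ, 0 < N →
      Radar.falseAlarmProb prior ψ α N₀ N =
        ∫ y, prior 1 * Radar.detectionStatistic ψ α N₀ N 1 y /
          (prior 0 + prior 1 * Radar.detectionStatistic ψ α N₀ N 1 y) ∂(Radar.noiseLaw N₀ N)) ∧
    Tendsto (fun N : ℕ => Radar.falseAlarmProb prior ψ α N₀ N) atTop (𝓝 (prior 1)) := by
  have hformula : ∀ N : ℕ, 0 < N → Radar.falseAlarmProb prior ψ α N₀ N =
      ∫ y, prior 1 * Radar.detectionStatistic ψ α N₀ N 1 y /
        (prior 0 + prior 1 * Radar.detectionStatistic ψ α N₀ N 1 y) ∂(Radar.noiseLaw N₀ N) :=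
    fun N hN => integral_congr_ae (ae_of_all _ fun y => Radar.posterior_one_eq prior ψ α hN₀ hN y)
  refine ⟨hformula, ?_⟩
  have hsqrt := (Real.continuous_sqrt.tendsto 0).comp
    (Radar.tendsto_integral_detectionStatistic_sub_one_sq (α := α) hψ hN₀)
  rw [Real.sqrt_zero] at hsqrt
  rw [tendsto_iff_norm_sub_tendsto_zero]
  refine squeeze_zero' (Eventually.of_forall fun N => norm_nonneg _) ?_ hsqrt
  filter_upwards [eventually_gt_atTop 0] with N hN
  rw [Function.comp_apply, Real.norm_eq_abs]
  refine Real.abs_le_sqrt ?_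
  have hΥ := Radar.integrable_detectionStatistic (α := α) hψ hN₀ hN
  have hΥ2 := Radar.integrable_detectionStatistic_sq (α := α) hψ hN₀ hN
  set W : (Fin N → ℂ) → ℝ := fun y => prior 1 * Radar.detectionStatistic ψ α N₀ N 1 y /
    (prior 0 + prior 1 * Radar.detectionStatistic ψ α N₀ N 1 y) - prior 1 with hW
  have hWle : ∀ y, |W y| ≤ |Radar.detectionStatistic ψ α N₀ N 1 y - 1| := fun y =>
    Radar.abs_posterior_sub_le (hprior 0) (hprior 1) hsum
      (Radar.detectionStatistic_one_pos hψ α N₀ hN y)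
  have hmeas : AEStronglyMeasurable (fun y => prior 1 * Radar.detectionStatistic ψ α N₀ N 1 y /
      (prior 0 + prior 1 * Radar.detectionStatistic ψ α N₀ N 1 y)) (Radar.noiseLaw N₀ N) :=
    ((hΥ.1.aemeasurable.const_mul _).div
      ((hΥ.1.aemeasurable.const_mul _).const_add _)).aestronglyMeasurable
  have hsub : Integrable (fun y => Radar.detectionStatistic ψ α N₀ N 1 y - 1)
      (Radar.noiseLaw N₀ N) := hΥ.sub (integrable_const _)
  have hsub2 : Integrable (fun y => (Radar.detectionStatistic ψ α N₀ N 1 y - 1) ^ 2)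
      (Radar.noiseLaw N₀ N) := by
    refine ((hΥ2.sub (hΥ.const_mul 2)).add (integrable_const 1)).congr (ae_of_all _ fun y => ?_)
    simp only [Pi.add_apply, Pi.sub_apply]
    ring
  have hWint : Integrable W (Radar.noiseLaw N₀ N) :=
    hsub.mono (hmeas.sub aestronglyMeasurable_const) (ae_of_all _ hWle)
  have hW2le : ∀ y, W y ^ 2 ≤ (Radar.detectionStatistic ψ α N₀ N 1 y - 1) ^ 2 := fun y =>
    sq_le_sq.2 (hWle y)
  have hW2int : Integrable (fun y => W y ^ 2) (Radar.noiseLaw N₀ N) :=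
    hsub2.mono (hWint.1.pow 2) (ae_of_all _ fun y => by
      rw [Real.norm_of_nonneg (sq_nonneg _), Real.norm_of_nonneg (sq_nonneg _)]
      exact hW2le y)
  have hmean : Radar.falseAlarmProb prior ψ α N₀ N - prior 1
      = ∫ y, W y ∂(Radar.noiseLaw N₀ N) := by
    have hfrac : Integrable (fun y => prior 1 * Radar.detectionStatistic ψ α N₀ N 1 y /
        (prior 0 + prior 1 * Radar.detectionStatistic ψ α N₀ N 1 y)) (Radar.noiseLaw N₀ N) :=
      (hWint.add (integrable_const (prior 1))).congr (ae_of_all _ fun y => by simp [hW])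
    rw [hformula N hN, hW, integral_sub hfrac (integrable_const _)]
    simp
  rw [hmean]
  -- Jensen's inequality passes from the mean deviation to the quadratic mean
  calc (∫ y, W y ∂(Radar.noiseLaw N₀ N)) ^ 2
      ≤ ∫ y, W y ^ 2 ∂(Radar.noiseLaw N₀ N) :=
        (even_two.convexOn_pow (𝕜 := ℝ)).map_integral_le (continuous_pow 2).continuousOn
          isClosed_univ (ae_of_all _ fun _ => Set.mem_univ _) hWint hW2int
    _ ≤ _ := integral_mono hW2int hsub2 hW2le
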